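/- A field is pythagorean if every sum of squares in it is a square. A field $k$ is hereditarily non-pythagorean if every proper finite extension $L/k$ that is not purely inseparable is non-pythagorean. For a field $E$ with a fixed algebraic closure $\overline{E}$, let $E_{\mathrm{pyth}}\subseteq\overline{E}$ (respectively $E_{\mathrm{quad}}\subseteq\overline{E}$) be the union of all fields $K_n$ occurring at the top of a finite chain $E=K_0\subseteq K_1\subseteq\dots\subseteq K_n\subseteq\overline{E}$ in which each $K_{i+1}$ is obtained from $K_i$ by adjoining a square root of a sum of two squares of elements of $K_i$ (respectively a square root of an arbitrary element of $K_i$). **Theorem.** Let $F$ be either a number field or a field of characteristic different from $2$ that is finitely generated (as a field extension) of transcendence degree at least one over a subfield. Let $E/F$ be an infinite Galois extension. Then $E_{\mathrm{pyth}}$ and $E_{\mathrm{quad}}$ are both hereditarily non-pythagorean. -/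

import Mathlib

universe u v w

/-- A field is pythagorean if every sum of squares in it is a square. -/
def IsPythagorean (K : Type u) [Field K] : Prop :=
  ∀ a : K, IsSumSq a → IsSquare a

/-- A field `k` is hereditarily non-pythagorean if every proper finite extension `L / k` that is
not purely inseparable is non-pythagorean. (A finite extension of `k` is, up to isomorphism,
a type in the universe of `k`.) -/
def IsHereditarilyNonPythagorean (k : Type u) [Field k] : Prop :=
  ∀ (L : Type u) [Field L] [Algebra k L],
    FiniteDimensional k L → 1 < Module.finrank k L → ¬ IsPurelyInseparable k L →
      ¬ IsPythagorean L

/-- The extensions of `E` inside `Ω` that are the top of a finite chain starting with `E`, in which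
each step adjoins a square root of a sum of two squares of the predecessor. -/
inductive IsPythTower (E : Type v) (Ω : Type w) [Field E] [Field Ω] [Algebra E Ω] :
    IntermediateField E Ω → Prop
  | base : IsPythTower E Ω ⊥
  | step (K : IntermediateField E Ω) (a b x : Ω) (hK : IsPythTower E Ω K) (ha : a ∈ K)
      (hb : b ∈ K) (hx : x ^ 2 = a ^ 2 + b ^ 2) :
      IsPythTower E Ω (K ⊔ IntermediateField.adjoin E {x})

/-- The extensions of `E` inside `Ω` that are the top of a finite chain starting with `E`, in which
each step adjoins a square root of an arbitrary element of the predecessor. -/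
inductive IsQuadTower (E : Type v) (Ω : Type w) [Field E] [Field Ω] [Algebra E Ω] :
    IntermediateField E Ω → Prop
  | base : IsQuadTower E Ω ⊥
  | step (K : IntermediateField E Ω) (a x : Ω) (hK : IsQuadTower E Ω K) (ha : a ∈ K)
      (hx : x ^ 2 = a) :
      IsQuadTower E Ω (K ⊔ IntermediateField.adjoin E {x})

/-- The pythagorean closure of `E` inside `Ω` (an algebraic closure of `E` in applications):
the compositum, which is also the directed union, of all towers of square roots of sums of
two squares. -/
def pythClosure (E : Type v) (Ω : Type w) [Field E] [Field Ω] [Algebra E Ω] :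
    IntermediateField E Ω :=
  sSup {K | IsPythTower E Ω K}

/-- The quadratic closure of `E` inside `Ω` (an algebraic closure of `E` in applications):
the compositum, which is also the directed union, of all towers of square roots. -/
def quadClosure (E : Type v) (Ω : Type w) [Field E] [Field Ω] [Algebra E Ω] :
    IntermediateField E Ω :=
  sSup {K | IsQuadTower E Ω K}

/-- `F` is finitely generated (as a field extension) of transcendence degree at least one over
some subfield. -/
def IsFGTranscendentalOverSubfield (F : Type u) [Field F] : Prop :=
  ∃ k : Subfield F, (⊤ : IntermediateField k F).FG ∧ 1 ≤ Algebra.trdeg k F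

/-! Let `N` be either closure. `N` is stable under all automorphisms of `Ω` over `F`, and `F` is
finite over the fraction field `Q` of `R`, where `R` is `ℤ` or a polynomial ring over a field.

Suppose `L / N` is finite, not purely inseparable and pythagorean. Embed `L` in `Ω`; some `a` in
`L`, separable over `Q`, is moved by some `g` fixing `N`. For `x` in `Q` write `1 + (x + a) ^ 2 = s
^ 2` with `s` in `L`. Let `M / F` be finite normal, containing `a`, a root `i` of `-1` and a basis
of `L / N`. An automorphism `h` over `M` sends `s` to `± s`, and it commutes with `g` on `L` by
stability of `N`. The signs cancel in `s * g s`, so `h` fixes this product. Hence for every `x` in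
`Q` the product `(1 + (x + a) ^ 2) * (1 + (x + g a) ^ 2)` is a square in one fixed finite separable
extension `K` of `Q`.

Arithmetic excludes this (`exists_not_isSquare_prod_sub`): the product is a quartic in `x` with a
simple root in `K`. At a suitable prime of `K` of degree one, some `x` makes the factor of that root
have valuation one and the other factors units, so the total valuation is odd. Such primes are
handled as roots modulo `p ^ n` of the minimal polynomial of a primitive element. -/

/-! ### Primes dividing polynomial values -/

/-- Every nonconstant polynomial over `R` takes a value that is neither zero nor a unit. -/
def HasNonunitValues (R : Type*) [CommRing R] : Prop :=
  ∀ P : Polynomial R, 0 < P.natDegree → ∃ c, P.eval c ≠ 0 ∧ ¬ IsUnit (P.eval c)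

theorem hasNonunitValues_int : HasNonunitValues ℤ := by
  intro P hP
  by_contra! H
  have h1 : P ^ 3 = P := by
    apply Polynomial.funext
    intro c
    rcases eq_or_ne (P.eval c) 0 with h | h
    · simp [h]
    · rcases Int.isUnit_iff.1 (H c h) with h | h <;> simp [h]
  have h2 := congrArg Polynomial.natDegree h1
  simp at h2
  omega

-- If all nonzero values were units, all values would be constants. Since `X ^ (n + 1)` divides `P
-- (X ^ (n + 1)) - P 0`, this difference would vanish for every `n`, giving `P - P 0` infinitely
-- many roots.
open Polynomial in
theorem hasNonunitValues_polynomial (k : Type*) [Field k] : HasNonunitValues k[X] := by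
  intro P hP
  by_contra! H
  have hu : ∀ c : k[X], (P.eval c).degree ≤ 0 := fun c => by
    rcases eq_or_ne (P.eval c) 0 with h | h
    · simp [h]
    · exact (Polynomial.degree_eq_zero_of_isUnit (H c h)).le
  have key : ∀ n : ℕ, P.eval (X ^ (n + 1)) = P.eval 0 := by
    intro n
    have hd : (X ^ (n + 1) - 0 : k[X]) ∣ P.eval (X ^ (n + 1)) - P.eval 0 :=
      Polynomial.sub_dvd_eval_sub _ _ _
    by_contra hne
    have h3 := Polynomial.degree_le_of_dvd hd (sub_ne_zero.2 hne)
    have h5 := (h3.trans (Polynomial.degree_sub_le _ _)).trans (max_le (hu _) (hu _))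
    rw [sub_zero, Polynomial.degree_X_pow] at h5
    norm_cast at h5
  have hz : P - C (P.eval 0) = 0 := by
    refine Polynomial.eq_zero_of_infinite_isRoot _ ?_
    refine Set.Infinite.mono (s := Set.range fun n : ℕ => (X ^ (n + 1) : k[X])) ?_ ?_
    · rintro _ ⟨n, rfl⟩
      simp [key n]
    · refine Set.infinite_range_of_injective fun m n hmn => ?_
      have := congrArg Polynomial.natDegree hmn
      simpa using this
  rw [sub_eq_zero.1 hz, Polynomial.natDegree_C] at hP
  exact lt_irrefl _ hP

-- Euclid's argument: with `d = h 0 ≠ 0`, the value `h (d * D * y)` is `d` times an element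
-- congruent to `1` modulo `D`, and a prime factor of the latter cannot divide `D`.
open Polynomial in
theorem HasNonunitValues.exists_prime_dvd_eval {R : Type*} [CommRing R] [IsDomain R]
    [IsPrincipalIdealRing R] (hR : HasNonunitValues R) (h : R[X]) (hh : 0 < h.natDegree)
    (D : R) (hD : D ≠ 0) : ∃ p c : R, Prime p ∧ ¬ p ∣ D ∧ p ∣ h.eval c := by
  have main : ∀ P : R[X], P ≠ 0 →
      ∃ p y : R, Prime p ∧ ¬ p ∣ D ∧ p ∣ 1 + D * y * P.eval y := by
    intro P hP
    have hdeg : 0 < (1 + X * (C D * P)).natDegree := by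
      rw [show (1 : R[X]) = C 1 from rfl, Polynomial.natDegree_C_add,
        Polynomial.natDegree_X_mul (mul_ne_zero (C_ne_zero.2 hD) hP)]
      omega
    obtain ⟨y, hy0, hy⟩ := hR _ hdeg
    have hev : (1 + X * (C D * P)).eval y = 1 + D * y * P.eval y := by
      simp; ring
    rw [hev] at hy hy0
    obtain ⟨p, hp, hpd⟩ := WfDvdMonoid.exists_irreducible_factor hy hy0
    refine ⟨p, y, hp.prime, fun hpD => hp.not_isUnit (isUnit_of_dvd_one ?_), hpd⟩
    refine (dvd_add_left (c := D * y * P.eval y) ?_).1 hpd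
    exact (hpD.mul_right _).mul_right _
  obtain hd | hd := eq_or_ne (h.eval 0) 0
  · obtain ⟨p, y, hp, hpD, -⟩ := main 1 one_ne_zero
    exact ⟨p, 0, hp, hpD, hd.symm ▸ dvd_zero p⟩
  · set d := h.eval 0
    have hc : h.coeff 0 = d := Polynomial.coeff_zero_eq_eval_zero h
    have hX : X * h.divX + C d = h := hc ▸ Polynomial.X_mul_divX_add h
    have hne : h.divX ≠ 0 := by
      intro h0
      rw [← hX, h0] at hh
      simp at hh
    obtain ⟨p, y, hp, hpD, hpy⟩ := main (h.divX.comp (C (d * D) * X)) (by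
      intro h0
      refine hne ((Polynomial.comp_eq_zero_iff.1 h0).resolve_right fun h1 => ?_)
      have := congrArg Polynomial.natDegree h1.2
      rw [Polynomial.natDegree_C_mul_X _ (mul_ne_zero hd hD)] at this
      simp at this)
    refine ⟨p, d * D * y, hp, hpD, ?_⟩
    have : h.eval (d * D * y) =
        d * (1 + D * y * (h.divX.comp (C (d * D) * X)).eval y) := by
      conv_lhs => rw [← hX]
      simp
      ring
    rw [this]
    exact hpy.mul_left _

/-! ### Hensel lifting and parity of valuations, modulo prime powers -/

open Polynomial in
theorem exists_hensel_step {R : Type*} [CommRing R] [IsDomain R] [IsPrincipalIdealRing R]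
    {h : R[X]} {p c : R} (hp : Prime p) (hc' : ¬ p ∣ h.derivative.eval c) {k : ℕ} (hk : 1 ≤ k)
    (hc : p ^ k ∣ h.eval c) : ∃ c', p ^ k ∣ c' - c ∧ p ^ (k + 1) ∣ h.eval c' := by
  -- Here `b` inverts the derivative modulo `p`, so `c - p ^ k * e * b` is the Newton correction.
  obtain ⟨a, b, hab⟩ := (Irreducible.coprime_iff_not_dvd hp.irreducible).2 hc'
  obtain ⟨e, he⟩ := hc
  obtain ⟨q, hq⟩ := h.binomExpansion c (p ^ k * (-(e * b)))
  refine ⟨c + p ^ k * (-(e * b)), ⟨-(e * b), by ring⟩, ?_⟩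
  obtain ⟨j, rfl⟩ := Nat.exists_eq_add_of_le hk
  refine ⟨e * a + q * p ^ j * (e * b) ^ 2, ?_⟩
  rw [hq, he]
  linear_combination (-p ^ (1 + j) * e) * hab

open Polynomial in
theorem exists_hensel {R : Type*} [CommRing R] [IsDomain R] [IsPrincipalIdealRing R]
    {h : R[X]} {p c : R} (hp : Prime p) (hc' : ¬ p ∣ h.derivative.eval c) {k : ℕ} (hk : 1 ≤ k)
    (hc : p ^ k ∣ h.eval c) (n : ℕ) : ∃ c', p ^ k ∣ c' - c ∧ p ^ (k + n) ∣ h.eval c' := by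
  induction n with
  | zero => exact ⟨c, by simp, hc⟩
  | succ n ih =>
    obtain ⟨c₁, h1, h2⟩ := ih
    have h3 : ¬ p ∣ h.derivative.eval c₁ := by
      intro h4
      refine hc' ((dvd_iff_dvd_of_dvd_sub ?_).1 h4)
      exact ((dvd_pow_self p (by omega)).trans h1).trans (Polynomial.sub_dvd_eval_sub _ _ _)
    obtain ⟨c₂, h5, h6⟩ := exists_hensel_step hp h3 (by omega) h2
    refine ⟨c₂, ?_, h6⟩
    have := dvd_add ((pow_dvd_pow p (by omega : k ≤ k + n)).trans h5) h1
    rwa [sub_add_sub_cancel] at this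

/-- In a principal ideal domain, `e ^ 2 * w` is not congruent to a square modulo high powers of
the prime `p`, if `p` divides `w` exactly once. -/
theorem exists_forall_not_pow_dvd_sq_mul_sub_sq {R : Type*} [CommRing R] [IsDomain R]
    [IsPrincipalIdealRing R] {p e : R} (hp : Prime p) (he : e ≠ 0) :
    ∃ n : ℕ, ∀ w s : R, p ∣ w → ¬ p ^ 2 ∣ w → ¬ p ^ n ∣ e ^ 2 * w - s ^ 2 := by
  obtain ⟨a, e', he', rfl⟩ := WfDvdMonoid.max_power_factor he hp.irreducible
  -- `e ^ 2 * w` has odd valuation `2 * a + 1`, which a congruence modulo `p ^ (2 * a + 2)` would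
  -- transfer to the square `s ^ 2`.
  refine ⟨2 * a + 2, fun w s h1 h2 h3 => ?_⟩
  have h4 : p ^ (2 * a) ∣ s ^ 2 := by
    refine (dvd_iff_dvd_of_dvd_sub
      ((pow_dvd_pow p (by omega : 2 * a ≤ 2 * a + 2)).trans h3)).1 ⟨e' ^ 2 * w, by ring⟩
  rw [mul_comm, pow_mul, UniqueFactorizationMonoid.pow_dvd_pow_iff_dvd two_ne_zero] at h4
  obtain ⟨t, rfl⟩ := h4
  have h5 : p ^ 2 ∣ e' ^ 2 * w - t ^ 2 := by
    refine (mul_dvd_mul_iff_left (pow_ne_zero (2 * a) hp.ne_zero)).1 ?_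
    rw [← pow_add]
    convert h3 using 1
    ring
  have h6 : p ∣ t := by
    refine hp.dvd_of_dvd_pow (n := 2) ?_
    refine (dvd_iff_dvd_of_dvd_sub ((dvd_pow_self p two_ne_zero).trans h5)).1 (h1.mul_left _)
  have h7 : p ^ 2 ∣ e' ^ 2 * w :=
    (dvd_iff_dvd_of_dvd_sub h5).2 (pow_dvd_pow_of_dvd h6 2)
  obtain ⟨w', rfl⟩ := h1
  have h8 : p ∣ e' ^ 2 * w' := by
    refine (mul_dvd_mul_iff_left hp.ne_zero).1 ?_
    convert h7 using 1 <;> ring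
  rcases hp.dvd_or_dvd h8 with h | h
  · exact he' (hp.dvd_of_dvd_pow h)
  · exact h2 (by rw [sq]; exact mul_dvd_mul_left _ h)

/-! ### Nonsquare values in a finite separable extension -/

section Arithmetic

open Polynomial

variable {R : Type*} [CommRing R] {Q : Type*} [Field Q] [Algebra R Q] {K : Type*} [Field K]
  [Algebra R K] [Algebra Q K] [IsScalarTower R Q K]

theorem exists_smul_eq_aeval [IsDomain R] [IsFractionRing R Q] {γ : K}
    (hγ : IntermediateField.adjoin Q {γ} = ⊤) (hint : IsIntegral Q γ) (z : K) :
    ∃ d : R, d ≠ 0 ∧ ∃ P : R[X], algebraMap R K d * z = aeval γ P := by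
  have hz : z ∈ IntermediateField.adjoin Q {γ} := hγ ▸ IntermediateField.mem_top
  rw [← IntermediateField.mem_toSubalgebra,
    IntermediateField.adjoin_simple_toSubalgebra_of_isAlgebraic hint.isAlgebraic,
    Algebra.adjoin_singleton_eq_range_aeval] at hz
  obtain ⟨P, rfl⟩ := hz
  obtain ⟨b, hb0, hb⟩ := IsLocalization.integerNormalization_spec (nonZeroDivisors R) P
  refine ⟨b, nonZeroDivisors.ne_zero hb0,
    IsLocalization.integerNormalization (nonZeroDivisors R) P, ?_⟩
  rw [← aeval_map_algebraMap Q, hb, Algebra.smul_def]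
  simp [IsScalarTower.algebraMap_apply R Q K]

theorem exists_common_smul_eq_aeval [IsDomain R] [IsFractionRing R Q] {γ : K}
    (hγ : IntermediateField.adjoin Q {γ} = ⊤) (hint : IsIntegral Q γ) {ι : Type*} [Fintype ι]
    (ρ : ι → K) :
    ∃ d : R, d ≠ 0 ∧ ∃ P : ι → R[X], ∀ i, algebraMap R K d * ρ i = aeval γ (P i) := by
  classical
  choose d hd P hP using fun i => exists_smul_eq_aeval (R := R) hγ hint (ρ i)
  refine ⟨∏ i, d i, Finset.prod_ne_zero_iff.2 fun i _ => hd i,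
    fun i => C (∏ j ∈ Finset.univ.erase i, d j) * P i, fun i => ?_⟩
  rw [← Finset.mul_prod_erase _ _ (Finset.mem_univ i), map_mul, map_mul, aeval_C, ← hP]
  ring

theorem exists_mul_aeval_eq_algebraMap [IsDomain R] [IsFractionRing R Q] {γ : K}
    (hγ : IntermediateField.adjoin Q {γ} = ⊤) (hint : IsIntegral Q γ) {z : K} (hz : z ≠ 0) :
    ∃ D : R, D ≠ 0 ∧ ∃ T : R[X], aeval γ T * z = algebraMap R K D := by
  obtain ⟨d, hd, P, hP⟩ := exists_smul_eq_aeval (R := R) hγ hint z⁻¹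
  refine ⟨d, hd, P, ?_⟩
  rw [← hP, mul_assoc, inv_mul_cancel₀ hz, mul_one]

/-- A root `c` of the minimal polynomial modulo `p` gives a specialization `γ ↦ c` from `R[γ]` to `R
/ p`, because over an integrally closed domain every relation is a multiple of the minimal
polynomial. Here `p` need not be prime; powers are used too. -/
theorem dvd_eval_of_aeval_eq_zero [IsDomain R] [IsIntegrallyClosed R]
    [Module.IsTorsionFree R K] {γ : K} (hint : IsIntegral R γ) {p c : R}
    (hc : p ∣ (minpoly R γ).eval c) {A : R[X]} (hA : aeval γ A = 0) : p ∣ A.eval c :=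
  hc.trans (eval_dvd (minpoly.isIntegrallyClosed_dvd hint hA))

/-- The multiple `D` of `A(γ)` certifies that `A(γ)` stays nonzero under specialization modulo any
`p` not dividing `D`. -/
theorem not_dvd_eval_of_aeval_mul [IsDomain R] [IsIntegrallyClosed R]
    [Module.IsTorsionFree R K] {γ : K} (hint : IsIntegral R γ) {p c D : R} {T A : R[X]}
    (hc : p ∣ (minpoly R γ).eval c) (hT : aeval γ T * aeval γ A = algebraMap R K D)
    (hD : ¬ p ∣ D) : ¬ p ∣ A.eval c := by
  intro h
  have h1 : p ∣ (T * A - C D).eval c :=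
    dvd_eval_of_aeval_eq_zero hint hc (by simp [hT])
  rw [eval_sub, eval_mul, eval_C] at h1
  exact hD ((dvd_iff_dvd_of_dvd_sub h1).1 (h.mul_left _))

/-- A polynomial that splits over a finite separable extension `K` of the fraction field `Q` of `R`
and has a simple root (and even degree) takes a value on `Q` that is not a square in `K`. -/
theorem exists_not_isSquare_prod_sub [IsDomain R] [IsPrincipalIdealRing R] [IsFractionRing R Q]
    (hR : HasNonunitValues R) [FiniteDimensional Q K] [Algebra.IsSeparable Q K]
    {ι : Type*} [Fintype ι] (hι : Even (Fintype.card ι)) (ρ : ι → K) (i₀ : ι)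
    (hρ : ∀ i, i ≠ i₀ → ρ i ≠ ρ i₀) :
    ∃ x : Q, ¬ IsSquare (∏ i, (algebraMap Q K x - ρ i)) := by
  classical
  have hinj : Function.Injective (algebraMap R K) := by
    rw [IsScalarTower.algebraMap_eq R Q K]
    exact (algebraMap Q K).injective.comp (IsFractionRing.injective R Q)
  have : Module.IsTorsionFree R K := Module.isTorsionFree_iff_algebraMap_injective.2 hinj
  have : FaithfulSMul R K := (faithfulSMul_iff_algebraMap_injective R K).2 hinj
  -- an integral primitive element
  obtain ⟨γ, hγ, hint⟩ : ∃ γ : K, IntermediateField.adjoin Q {γ} = ⊤ ∧ IsIntegral R γ := by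
    obtain ⟨γ, hγ⟩ := Field.exists_primitive_element Q K
    have : Algebra.IsAlgebraic R K := by
      have := IsFractionRing.comap_isAlgebraic_iff (A := R) (K := Q) (C := K)
      exact this.2 inferInstance
    obtain ⟨y, hy, hi⟩ := (Algebra.IsAlgebraic.isAlgebraic (R := R) γ).exists_integral_multiple
    refine ⟨y • γ, ?_, hi⟩
    rw [eq_top_iff, ← hγ, IntermediateField.adjoin_simple_le_iff]
    have h0 : algebraMap R K y ≠ 0 := by
      rwa [Ne, map_eq_zero_iff _ hinj]
    have : (algebraMap Q K (algebraMap R Q y))⁻¹ * (y • γ) = γ := by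
      rw [← IsScalarTower.algebraMap_apply, Algebra.smul_def, inv_mul_cancel_left₀ h0]
    refine (congrArg (· ∈ IntermediateField.adjoin Q {y • γ}) this).mp ?_
    exact mul_mem (inv_mem (algebraMap_mem _ _)) (IntermediateField.mem_adjoin_simple_self _ _)
  have hintQ : IsIntegral Q γ := Algebra.IsIntegral.isIntegral γ
  set h := minpoly R γ with hh
  have hmap : minpoly Q γ = h.map (algebraMap R Q) :=
    minpoly.isIntegrallyClosed_eq_field_fractions' Q hint
  obtain ⟨d, hd, P, hP⟩ := exists_common_smul_eq_aeval (R := R) hγ hintQ ρ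
  have hd' : algebraMap R K d ≠ 0 := by rwa [Ne, map_eq_zero_iff _ hinj]
  have hder : aeval γ (derivative h) ≠ 0 := by
    have := (Algebra.IsSeparable.isSeparable Q γ : (minpoly Q γ).Separable).aeval_derivative_ne_zero
      (minpoly.aeval Q γ)
    rwa [hmap, derivative_map, aeval_map_algebraMap] at this
  obtain ⟨D₀, hD₀, T₀, hT₀⟩ := exists_mul_aeval_eq_algebraMap (R := R) hγ hintQ hder
  have hdiff : ∀ i, ∃ D : R, D ≠ 0 ∧ ∃ T : R[X],
      i ≠ i₀ → aeval γ T * aeval γ (P i₀ - P i) = algebraMap R K D := by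
    intro i
    by_cases hi : i = i₀
    · exact ⟨1, one_ne_zero, 0, fun h => absurd hi h⟩
    · have : aeval γ (P i₀ - P i) ≠ 0 := by
        rw [map_sub, ← hP, ← hP, ← mul_sub]
        exact mul_ne_zero hd' (sub_ne_zero.2 (hρ i hi).symm)
      obtain ⟨D, hD, T, hT⟩ := exists_mul_aeval_eq_algebraMap (R := R) hγ hintQ this
      exact ⟨D, hD, T, fun _ => hT⟩
  choose D hD T hT using hdiff
  -- Avoiding `D₀` makes the root simple modulo `p`; avoiding each `D i` keeps `ρ i` apart from `ρ
  -- i₀` modulo `p`.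
  obtain ⟨p, c₁, hp, hpD, hpc₁⟩ := hR.exists_prime_dvd_eval h (minpoly.natDegree_pos hint)
    (D₀ * ∏ i, D i) (mul_ne_zero hD₀ (Finset.prod_ne_zero_iff.2 fun i _ => hD i))
  have hpD₀ : ¬ p ∣ D₀ := fun h => hpD (h.mul_right _)
  have hpDi : ∀ i, ¬ p ∣ D i := fun i h =>
    hpD ((h.trans (Finset.dvd_prod_of_mem _ (Finset.mem_univ i))).mul_left _)
  -- The precision `n` needed later depends on the alleged square root, hence on `y`. A root modulo
  -- `p ^ 2` already suffices to choose `y`: later lifts are congruent to `c` modulo `p ^ 2`, so `y`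
  -- minus the specialized `P i₀` keeps valuation exactly one.
  obtain ⟨c, -, hc⟩ := exists_hensel hp (not_dvd_eval_of_aeval_mul hint hpc₁ hT₀ hpD₀) le_rfl
    (by rwa [pow_one]) 1
  have hpc : p ∣ h.eval c := (dvd_pow_self p two_ne_zero).trans hc
  set y : R := (P i₀).eval c + p with hy
  refine ⟨algebraMap R Q y / algebraMap R Q d, ?_⟩
  rintro ⟨s, hs⟩
  -- Clearing the denominator `d` from each factor multiplies the product by `d ^ card ι`, a square
  -- since `card ι` is even.
  obtain ⟨e, he, S, hS⟩ := exists_smul_eq_aeval (R := R) hγ hintQ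
    (algebraMap R K d ^ (Fintype.card ι / 2) * s)
  obtain ⟨n, hn⟩ := exists_forall_not_pow_dvd_sq_mul_sub_sq hp he
  obtain ⟨c', hcc', hc'⟩ := exists_hensel hp (not_dvd_eval_of_aeval_mul hint hpc hT₀ hpD₀)
    (by norm_num : 1 ≤ 2) hc n
  have hpc' : p ∣ h.eval c' := (dvd_pow_self p (by omega)).trans hc'
  obtain ⟨t, ht⟩ : p ^ 2 ∣ (P i₀).eval c - (P i₀).eval c' :=
    (dvd_sub_comm.1 hcc').trans (sub_dvd_eval_sub _ _ _)
  have hfac : y - (P i₀).eval c' = p * (1 + p * t) := by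
    linear_combination hy + ht
  have hprod : (∏ i, (C y - P i)).eval c' =
      p * ((1 + p * t) * ∏ i ∈ Finset.univ.erase i₀, (y - (P i).eval c')) := by
    rw [eval_prod, ← Finset.mul_prod_erase _ _ (Finset.mem_univ i₀)]
    simp only [eval_sub, eval_C]
    rw [hfac, mul_assoc]
  refine hn ((∏ i, (C y - P i)).eval c') (S.eval c') ?_ ?_ ?_
  · exact hprod ▸ dvd_mul_right _ _
  · rw [hprod, sq, mul_dvd_mul_iff_left hp.ne_zero, hp.dvd_mul, hp.dvd_finsetProd_iff]
    rintro (h1 | ⟨i, hi, h1⟩)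
    · exact hp.not_dvd_one ((dvd_add_left (dvd_mul_right p t)).1 h1)
    -- Modulo `p`, `y` agrees with `P i₀` at `c'`, so this factor is the specialized difference `P
    -- i₀ - P i`.
    · refine not_dvd_eval_of_aeval_mul hint hpc' (hT i (Finset.ne_of_mem_erase hi)) (hpDi i) ?_
      refine (dvd_iff_dvd_of_dvd_sub ?_).1 h1
      refine ⟨1 + p * t, ?_⟩
      rw [← hfac, eval_sub]
      ring
  · have hA : aeval γ (C (e ^ 2) * ∏ i, (C y - P i) - S ^ 2) = 0 := by
      have h1 : ∀ i, algebraMap R K y - aeval γ (P i) = algebraMap R K d *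
          (algebraMap Q K (algebraMap R Q y / algebraMap R Q d) - ρ i) := by
        intro i
        rw [← hP, map_div₀, ← IsScalarTower.algebraMap_apply, ← IsScalarTower.algebraMap_apply,
          mul_sub, mul_div_cancel₀ _ hd']
      simp only [map_sub, map_mul, map_pow, map_prod, aeval_C, h1]
      rw [Finset.prod_mul_distrib, hs, ← hS, Finset.prod_const, Finset.card_univ]
      obtain ⟨m, hm⟩ := hι
      rw [hm, show (m + m) / 2 = m by omega]
      ring
    have := dvd_eval_of_aeval_eq_zero hint ((pow_dvd_pow p (by omega)).trans hc' :
      p ^ n ∣ h.eval c') hA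
    simpa using this

end Arithmetic

/-! ### Galois descent of the square root -/

theorem mem_range_algebraMap_of_isSeparable_of_forall_algEquiv {K Ω : Type*} [Field K] [Field Ω]
    [Algebra K Ω] [Normal K Ω] {x : Ω} (hx : IsSeparable K x) (h : ∀ g : Ω ≃ₐ[K] Ω, g x = x) :
    x ∈ Set.range (algebraMap K Ω) := by
  by_contra hn
  obtain ⟨y, hy, hc⟩ := (notMem_iff_exists_ne_and_isConjRoot hx (Normal.splits inferInstance x)).1
    (fun h => hn (Algebra.mem_bot.1 h))
  obtain ⟨g, hg⟩ := isConjRoot_iff_exists_algEquiv.1 hc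
  exact hy (hg.symm.trans (g.injective ((congrArg g hg).trans ((h g).trans hg.symm))))

theorem exists_algEquiv_apply_ne {N L Ω : Type*} [Field N] [Field L] [Field Ω] [Algebra N L]
    [Algebra N Ω] [Normal N Ω] [Algebra.IsAlgebraic N L] (hL : ¬ IsPurelyInseparable N L)
    (j : L →ₐ[N] Ω) : ∃ (θ : L) (g : Ω ≃ₐ[N] Ω), g (j θ) ≠ j θ := by
  rw [← separableClosure.eq_bot_iff, ← le_bot_iff, SetLike.not_le_iff_exists] at hL
  obtain ⟨θ, h1, h2⟩ := hL
  by_contra! H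
  refine h2 ?_
  obtain ⟨n, hn⟩ := mem_range_algebraMap_of_isSeparable_of_forall_algEquiv (K := N) (x := j θ)
    (by rw [← mem_separableClosure_iff, map_mem_separableClosure_iff]; exact h1) (H θ)
  rw [← j.commutes] at hn
  exact IntermediateField.mem_bot.2 ⟨n, j.injective hn⟩

theorem mem_separableClosure_of_sq_mem {Q Ω : Type*} [Field Q] [Field Ω] [Algebra Q Ω]
    (h2 : (2 : Ω) ≠ 0) {x : Ω} (hx : x ^ 2 ∈ separableClosure Q Ω) :
    x ∈ separableClosure Q Ω := by
  rcases eq_or_ne x 0 with rfl | h0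
  · exact zero_mem _
  have hbot := separableClosure.separableClosure_eq_bot Q Ω
  have hs : x ∈ separableClosure (separableClosure Q Ω) Ω := by
    rw [mem_separableClosure_iff]
    have h2' : (2 : separableClosure Q Ω) ≠ 0 := fun h => h2 (congrArg Subtype.val h)
    have hsep : (Polynomial.X ^ 2 -
        Polynomial.C (⟨x ^ 2, hx⟩ : separableClosure Q Ω)).Separable :=
      Polynomial.separable_X_pow_sub_C _ (by exact_mod_cast h2')
        (fun h => pow_ne_zero 2 h0 (congrArg Subtype.val h))
    refine hsep.of_dvd (minpoly.dvd _ _ ?_)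
    simp
  rw [hbot] at hs
  obtain ⟨y, rfl⟩ := IntermediateField.mem_bot.1 hs
  exact y.2

theorem exists_sq_eq_neg_one_and_ne {Ω : Type*} [Field Ω] [IsAlgClosed Ω] (h2 : (2 : Ω) ≠ 0)
    (b : Ω) : ∃ i : Ω, i ^ 2 = -1 ∧ b ≠ 2 * i := by
  obtain ⟨i, hi⟩ := IsAlgClosed.exists_pow_nat_eq (-1 : Ω) two_pos
  have hi0 : i ≠ 0 := by
    rintro rfl
    norm_num at hi
  by_cases hb : b = 2 * i
  · refine ⟨-i, by rw [neg_sq, hi], fun h => ?_⟩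
    have : 2 * (2 * i) = 0 := by linear_combination h - hb
    exact mul_ne_zero h2 (mul_ne_zero h2 hi0) this
  · exact ⟨i, hi, hb⟩

/-- A special case of Weissauer's theorem: if `F` is finite over the fraction field of a principal
ideal domain with nonunit values and `N` is stable under all automorphisms over `F`, then a finite
extension `L` of `N` that is not purely inseparable is not pythagorean. -/
theorem not_isPythagorean_of_finite_of_not_isPurelyInseparable
    {R Q F N L Ω : Type*} [CommRing R] [IsDomain R] [IsPrincipalIdealRing R]
    (hR : HasNonunitValues R) [Field Q] [Algebra R Q] [IsFractionRing R Q]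
    [Field F] [Algebra Q F] [FiniteDimensional Q F]
    [Field Ω] [IsAlgClosed Ω] [Algebra F Ω] [Algebra Q Ω] [IsScalarTower Q F Ω]
    [Algebra.IsAlgebraic F Ω] (h2 : (2 : Ω) ≠ 0)
    [Field N] [Algebra N Ω] [Algebra F N] [IsScalarTower F N Ω]
    (hN : ∀ (h : Ω ≃ₐ[F] Ω) (n : N), h (algebraMap N Ω n) ∈ Set.range (algebraMap N Ω))
    [Field L] [Algebra N L] [FiniteDimensional N L] (hL : ¬ IsPurelyInseparable N L) :
    ¬ IsPythagorean L := by
  intro hpy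
  have : Algebra.IsAlgebraic N Ω := Algebra.IsAlgebraic.tower_top (K := F) N
  have : Algebra.IsAlgebraic Q Ω := Algebra.IsAlgebraic.trans Q F Ω
  have : IsAlgClosure N Ω := ⟨inferInstance, inferInstance⟩
  have : IsAlgClosure F Ω := ⟨inferInstance, inferInstance⟩
  have : Normal N Ω := IsAlgClosure.normal N Ω
  have : Normal F Ω := IsAlgClosure.normal F Ω
  let j : L →ₐ[N] Ω := IsAlgClosed.lift
  obtain ⟨θ, a, g, hθ, hsep, hg⟩ : ∃ (θ : L) (a : Ω) (g : Ω ≃ₐ[N] Ω), j θ = a ∧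
      a ∈ separableClosure Q Ω ∧ g a ≠ a := by
    obtain ⟨θ, g, hg⟩ := exists_algEquiv_apply_ne hL j
    -- A `q`-power of `θ` becomes separable over `Q`, and injectivity of Frobenius ensures that `g`
    -- still moves it.
    obtain ⟨q, hq⟩ := ExpChar.exists (separableClosure Q Ω)
    have : ExpChar Ω q := expChar_of_injective_algebraMap
      (algebraMap (separableClosure Q Ω) Ω).injective q
    obtain ⟨n, y, hy⟩ := IsPurelyInseparable.pow_mem (separableClosure Q Ω) q (j θ)
    refine ⟨θ ^ q ^ n, _, g, map_pow _ _ _, hy ▸ y.2, fun h => hg ?_⟩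
    rw [map_pow] at h
    exact iterateFrobenius_inj Ω q n h
  obtain ⟨i, hi, hai⟩ := exists_sq_eq_neg_one_and_ne h2 (a - g a)
  have hi0 : i ≠ 0 := by
    rintro rfl
    norm_num at hi
  -- a finite normal extension of `F` containing all the elements involved
  let b := Module.finBasis N L
  let S : Set Ω := Set.range (fun k => j (b k)) ∪ {a, i}
  have hS : S.Finite := (Set.finite_range _).union (by simp)
  have : FiniteDimensional F (IntermediateField.adjoin F S) :=
    have := hS.to_subtype
    IntermediateField.finiteDimensional_adjoin fun x _ => Algebra.IsIntegral.isIntegral x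
  let M := IntermediateField.normalClosure F (IntermediateField.adjoin F S) Ω
  have hSM : S ⊆ M := (IntermediateField.subset_adjoin F S).trans
    (IntermediateField.le_normalClosure _)
  have hMn : ∀ (σ : Ω ≃ₐ[F] Ω) (x : Ω), x ∈ M → σ x ∈ M := fun σ x hx =>
    (IntermediateField.normal_iff_forall_map_le'.1 (inferInstance : Normal F M)) σ ⟨x, hx, rfl⟩
  have hgM : ∀ x ∈ M, g x ∈ M := hMn (g.restrictScalars F)
  have hfix : ∀ (h : Ω ≃ₐ[M] Ω) (x : Ω), x ∈ M → h x = x := fun h x hx => h.commutes ⟨x, hx⟩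
  -- On the basis of `L / N`, `h` fixes both `b k` and `g (b k)`. On a coefficient `n` in `N`,
  -- stability puts `h n` in `N`, so `g` fixes `n` and `h n`.
  have hcomm : ∀ (h : Ω ≃ₐ[M] Ω) (s : L), h (g (j s)) = g (h (j s)) := by
    intro h s
    rw [← b.sum_repr s]
    simp only [map_sum, Algebra.smul_def, map_mul, AlgHom.commutes, AlgEquiv.commutes]
    refine Finset.sum_congr rfl fun k _ => ?_
    have hk : j (b k) ∈ M := hSM (Or.inl ⟨k, rfl⟩)
    rw [hfix h _ hk, hfix h _ (hgM _ hk)]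
    obtain ⟨n, hn⟩ := hN (h.restrictScalars F) (b.repr s k)
    change _ = h _ at hn
    rw [← hn, AlgEquiv.commutes]
  have haM : a ∈ M := hSM (Or.inr (by simp))
  have hiM : i ∈ M := hSM (Or.inr (by simp))
  have hgsep : g a ∈ separableClosure Q Ω :=
    (map_mem_separableClosure_iff ((g.restrictScalars F).restrictScalars Q).toAlgHom).2 hsep
  have hisep : i ∈ separableClosure Q Ω := mem_separableClosure_of_sq_mem h2 (by
    rw [hi]; exact neg_mem (one_mem _))
  -- `M / Q` may be inseparable, while the arithmetic needs a primitive element; the separable part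
  -- suffices because `a`, `g a`, `i` and the final square root all lie in it.
  let K : IntermediateField Q Ω := M.restrictScalars Q ⊓ separableClosure Q Ω
  have : Algebra.IsSeparable Q K := (le_separableClosure_iff Q Ω K).1 inf_le_right
  have : FiniteDimensional Q M := FiniteDimensional.trans Q F M
  have : FiniteDimensional Q (M.restrictScalars Q) := this
  have : FiniteDimensional Q K :=
    Module.Finite.of_injective (IntermediateField.inclusion
      (inf_le_left : K ≤ M.restrictScalars Q)).toLinearMap
      (IntermediateField.inclusion (inf_le_left : K ≤ M.restrictScalars Q)).injective
  let a₁ : K := ⟨a, haM, hsep⟩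
  let a₂ : K := ⟨g a, hgM a haM, hgsep⟩
  let i₁ : K := ⟨i, hiM, hisep⟩
  let : Algebra R K := ((algebraMap Q K).comp (algebraMap R Q)).toAlgebra
  have : IsScalarTower R Q K := .of_algebraMap_eq' rfl
  -- The entries are the roots in `x` of `1 + (x + a) ^ 2` and `1 + (x + g a) ^ 2`. The root `i - a`
  -- is simple: `2 * i ≠ 0`, `g a ≠ a`, and the sign of `i` was chosen so that `a - g a ≠ 2 * i`.
  obtain ⟨x, hx⟩ := exists_not_isSquare_prod_sub (Q := Q) hR (K := K) (ι := Fin 4) 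
    (by rw [Fintype.card_fin]; decide)
    ![i₁ - a₁, -i₁ - a₁, i₁ - a₂, -i₁ - a₂] 0 (by
      intro k hk h
      have h := congrArg Subtype.val h
      fin_cases k
      · exact hk rfl
      · have h : -i - a = i - a := h
        exact mul_ne_zero h2 hi0 (by linear_combination -h)
      · have h : i - g a = i - a := h
        exact hg (by linear_combination -h)
      · have h : -i - g a = i - a := h
        exact hai (by linear_combination h))
  refine hx ?_
  let y : N := algebraMap F N (algebraMap Q F x)
  have hy : algebraMap N Ω y = algebraMap Q Ω x := by
    rw [← IsScalarTower.algebraMap_apply, ← IsScalarTower.algebraMap_apply]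
  obtain ⟨s, hs⟩ := hpy (1 * 1 + ((algebraMap N L y + θ) * (algebraMap N L y + θ) + 0))
    (.sq_add _ (.sq_add _ .zero))
  have hjs : j s ^ 2 = 1 + (algebraMap Q Ω x + a) ^ 2 := by
    have := congrArg j hs
    simp only [map_add, map_mul, map_one, map_zero, AlgHom.commutes, hy, hθ] at this
    linear_combination -this
  have hgs : g (j s) ^ 2 = 1 + (algebraMap Q Ω x + g a) ^ 2 := by
    rw [← map_pow, hjs, map_add, map_pow, map_add, map_one, ← hy, AlgEquiv.commutes]
  have hxM : algebraMap Q Ω x ∈ M := (IsScalarTower.algebraMap_apply Q F Ω x) ▸ algebraMap_mem M _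
  have hz : ∀ h : Ω ≃ₐ[M] Ω, h (j s * g (j s)) = j s * g (j s) := by
    intro h
    have h1 : h (j s) ^ 2 = j s ^ 2 := by
      rw [← map_pow, hjs]
      exact hfix h _ (add_mem (one_mem _) (pow_mem (add_mem hxM haM) 2))
    rw [map_mul, hcomm]
    -- The same sign occurs in `h (j s)` and in `g (h (j s))`, so it cancels.
    rcases sq_eq_sq_iff_eq_or_eq_neg.1 h1 with h1 | h1 <;> simp [h1]
  have hzsq : (j s * g (j s)) ^ 2 =
      (1 + (algebraMap Q Ω x + a) ^ 2) * (1 + (algebraMap Q Ω x + g a) ^ 2) := by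
    rw [mul_pow, hjs, hgs]
  have hzsep : j s * g (j s) ∈ separableClosure Q Ω := by
    refine mem_separableClosure_of_sq_mem h2 ?_
    rw [hzsq]
    exact mul_mem (add_mem (one_mem _) (pow_mem (add_mem (algebraMap_mem _ _) hsep) 2))
      (add_mem (one_mem _) (pow_mem (add_mem (algebraMap_mem _ _) hgsep) 2))
  have hzM : j s * g (j s) ∈ M := by
    have : IsScalarTower Q M Ω := .of_algebraMap_eq fun x => by
      rw [IsScalarTower.algebraMap_apply Q F M, ← IsScalarTower.algebraMap_apply F M Ω,
        ← IsScalarTower.algebraMap_apply]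
    have : IsSeparable M (j s * g (j s)) :=
      IsSeparable.tower_top M (mem_separableClosure_iff.1 hzsep)
    obtain ⟨m, hm⟩ := mem_range_algebraMap_of_isSeparable_of_forall_algEquiv this hz
    exact hm ▸ m.2
  refine ⟨⟨j s * g (j s), hzM, hzsep⟩, Subtype.ext ?_⟩
  rw [Fin.prod_univ_four]
  change (algebraMap Q Ω x - (i - a)) * (algebraMap Q Ω x - (-i - a)) *
    (algebraMap Q Ω x - (i - g a)) * (algebraMap Q Ω x - (-i - g a)) =
      (j s * g (j s)) * (j s * g (j s))
  rw [← sq, hzsq]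
  have h1 : (1 : Ω) = -(i ^ 2) := by rw [hi, neg_neg]
  rw [h1]
  ring

/-! ### Pythagorean and quadratic closures and their stability under automorphisms -/

section Closures

variable {E : Type v} {Ω : Type w} [Field E] [Field Ω] [Algebra E Ω]

theorem IsPythTower.sup {K₁ K₂ : IntermediateField E Ω} (h₁ : IsPythTower E Ω K₁)
    (h₂ : IsPythTower E Ω K₂) : IsPythTower E Ω (K₁ ⊔ K₂) := by
  induction h₂ with
  | base => rwa [sup_bot_eq]
  | step K a b x _ ha hb hx ih =>
    rw [← sup_assoc]
    exact ih.step _ a b x ((le_sup_right : K ≤ K₁ ⊔ K) ha) ((le_sup_right : K ≤ K₁ ⊔ K) hb) hx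

theorem IsQuadTower.sup {K₁ K₂ : IntermediateField E Ω} (h₁ : IsQuadTower E Ω K₁)
    (h₂ : IsQuadTower E Ω K₂) : IsQuadTower E Ω (K₁ ⊔ K₂) := by
  induction h₂ with
  | base => rwa [sup_bot_eq]
  | step K a x _ ha hx ih =>
    rw [← sup_assoc]
    exact ih.step _ a x ((le_sup_right : K ≤ K₁ ⊔ K) ha) hx

theorem IntermediateField.mem_sSup_of_directedOn {s : Set (IntermediateField E Ω)}
    (hne : s.Nonempty) (hs : DirectedOn (· ≤ ·) s) {x : Ω} :
    x ∈ sSup s ↔ ∃ K ∈ s, x ∈ K := by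
  have := hne.to_subtype
  rw [sSup_eq_iSup', ← SetLike.mem_coe, coe_iSup_of_directed hs.directed_val]
  simp

theorem mem_pythClosure {x : Ω} : x ∈ pythClosure E Ω ↔ ∃ K, IsPythTower E Ω K ∧ x ∈ K :=
  IntermediateField.mem_sSup_of_directedOn ⟨⊥, .base⟩
    fun _ h₁ _ h₂ => ⟨_, IsPythTower.sup h₁ h₂, le_sup_left, le_sup_right⟩

theorem mem_quadClosure {x : Ω} : x ∈ quadClosure E Ω ↔ ∃ K, IsQuadTower E Ω K ∧ x ∈ K :=
  IntermediateField.mem_sSup_of_directedOn ⟨⊥, .base⟩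
    fun _ h₁ _ h₂ => ⟨_, IsQuadTower.sup h₁ h₂, le_sup_left, le_sup_right⟩

theorem mem_pythClosure_of_sq_eq {a b x : Ω} (ha : a ∈ pythClosure E Ω)
    (hb : b ∈ pythClosure E Ω) (hx : x ^ 2 = a ^ 2 + b ^ 2) : x ∈ pythClosure E Ω := by
  obtain ⟨K₁, h₁, ha⟩ := mem_pythClosure.1 ha
  obtain ⟨K₂, h₂, hb⟩ := mem_pythClosure.1 hb
  exact mem_pythClosure.2 ⟨_, (h₁.sup h₂).step _ a b x ((le_sup_left : K₁ ≤ K₁ ⊔ K₂) ha)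
    ((le_sup_right : K₂ ≤ K₁ ⊔ K₂) hb) hx, (le_sup_right : _ ≤ K₁ ⊔ K₂ ⊔ _)
      (IntermediateField.mem_adjoin_simple_self E x)⟩

theorem mem_quadClosure_of_sq_mem {x : Ω} (hx : x ^ 2 ∈ quadClosure E Ω) :
    x ∈ quadClosure E Ω := by
  obtain ⟨K, h, ha⟩ := mem_quadClosure.1 hx
  exact mem_quadClosure.2 ⟨_, h.step _ _ x ha rfl, (le_sup_right : _ ≤ K ⊔ _)
      (IntermediateField.mem_adjoin_simple_self E x)⟩

theorem pythClosure_le {N : IntermediateField E Ω}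
    (hN : ∀ a ∈ N, ∀ b ∈ N, ∀ x, x ^ 2 = a ^ 2 + b ^ 2 → x ∈ N) : pythClosure E Ω ≤ N := by
  refine sSup_le fun K hK => ?_
  induction hK with
  | base => exact bot_le
  | step K a b x _ ha hb hx ih =>
    exact sup_le ih (IntermediateField.adjoin_simple_le_iff.2 (hN a (ih ha) b (ih hb) x hx))

theorem quadClosure_le {N : IntermediateField E Ω}
    (hN : ∀ x, x ^ 2 ∈ N → x ∈ N) : quadClosure E Ω ≤ N := by
  refine sSup_le fun K hK => ?_
  induction hK with
  | base => exact bot_le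
  | step K a x _ ha hx ih =>
    exact sup_le ih (IntermediateField.adjoin_simple_le_iff.2 (hN x (hx ▸ ih ha)))

/-- The preimage of an intermediate field under a ring endomorphism that preserves the base. -/
def IntermediateField.comapRingHom (h : Ω →+* Ω) (N : IntermediateField E Ω)
    (hE : ∀ e : E, h (algebraMap E Ω e) ∈ N) : IntermediateField E Ω :=
  (N.toSubfield.comap h).toIntermediateField hE

variable {F : Type u} [Field F] [Algebra F E] [Algebra F Ω] [IsScalarTower F E Ω] [Normal F E]

theorem algEquiv_algebraMap_mem (h : Ω ≃ₐ[F] Ω) (N : IntermediateField E Ω) (e : E) :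
    h (algebraMap E Ω e) ∈ N := by
  have := AlgHom.restrictNormal_commutes (h : Ω →ₐ[F] Ω) E e
  exact (this.symm.trans rfl : h (algebraMap E Ω e) = _) ▸ algebraMap_mem N _

/-- By normality `h` maps `E` into itself, so the preimage of the closure under `h` contains `E`. It
is closed under the same square roots, and minimality of the closure applies. -/
theorem algEquiv_mem_pythClosure (h : Ω ≃ₐ[F] Ω) {x : Ω} (hx : x ∈ pythClosure E Ω) :
    h x ∈ pythClosure E Ω := by
  refine pythClosure_le (N := (pythClosure E Ω).comapRingHom (h : Ω →+* Ω)
    (algEquiv_algebraMap_mem h _)) ?_ hx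
  intro a ha b hb x hx
  refine mem_pythClosure_of_sq_eq ha hb ?_
  simpa using congrArg h hx

theorem algEquiv_mem_quadClosure (h : Ω ≃ₐ[F] Ω) {x : Ω} (hx : x ∈ quadClosure E Ω) :
    h x ∈ quadClosure E Ω := by
  refine quadClosure_le (N := (quadClosure E Ω).comapRingHom (h : Ω →+* Ω)
    (algEquiv_algebraMap_mem h _)) ?_ hx
  intro x hx
  refine mem_quadClosure_of_sq_mem ?_
  rw [← map_pow]
  exact hx

end Closures

/-! ### Finitely generated fields over a rational function field -/

-- Generators are moved into the base field one at a time while `F` stays transcendental over it;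
-- the generator that would first make `F` algebraic is `t`.
open IntermediateField in
theorem exists_transcendental_finiteDimensional_adjoin_simple {F : Type u} [Field F] (S : Finset F) :
    ∀ (k : Type u) [Field k] [Algebra k F], adjoin k (S : Set F) = ⊤ →
      ¬ Algebra.IsAlgebraic k F →
      ∃ (k' : Type u) (_ : Field k') (_ : Algebra k' F) (t : F), Transcendental k' t ∧
        FiniteDimensional k'⟮t⟯ F := by
  classical
  induction S using Finset.induction_on with
  | empty =>
    intro k _ _ hS halg
    refine absurd ?_ halg
    have h : (⊤ : IntermediateField k F) = ⊥ := by rw [← hS]; simp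
    refine ⟨fun x => ?_⟩
    obtain ⟨y, rfl⟩ := mem_bot.1 (h ▸ mem_top : x ∈ (⊥ : IntermediateField k F))
    exact isAlgebraic_algebraMap y
  | insert s S _ ih =>
    intro k _ _ hS halg
    have hS' : adjoin k⟮s⟯ (S : Set F) = ⊤ := by
      refine restrictScalars_injective k ?_
      rw [adjoin_adjoin_left, Set.singleton_union, ← Finset.coe_insert, hS, restrictScalars_top]
    by_cases h : Algebra.IsAlgebraic k⟮s⟯ F
    · refine ⟨k, inferInstance, inferInstance, s, fun hs => halg ?_, ?_⟩
      · have : Algebra.IsAlgebraic k k⟮s⟯ := isAlgebraic_adjoin_simple hs.isIntegral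
        exact Algebra.IsAlgebraic.trans k k⟮s⟯ F
      · have : FiniteDimensional k⟮s⟯ (adjoin k⟮s⟯ (S : Set F)) :=
          finiteDimensional_adjoin fun x _ => Algebra.IsIntegral.isIntegral x
        rw [hS'] at this
        exact topEquiv.toLinearEquiv.finiteDimensional
    · exact ih k⟮s⟯ hS' h

/-- A field that is finitely generated and transcendental over a subfield is finite over the
fraction field of a principal ideal domain with nonunit values, namely a polynomial ring. -/
theorem IsFGTranscendentalOverSubfield.exists_finiteDimensional {F : Type u} [Field F]
    (hF : IsFGTranscendentalOverSubfield F) :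
    ∃ (R Q : Type u) (_ : CommRing R) (_ : Field Q) (_ : Algebra R Q) (_ : Algebra Q F),
      IsDomain R ∧ IsPrincipalIdealRing R ∧ HasNonunitValues R ∧ IsFractionRing R Q ∧
        FiniteDimensional Q F := by
  obtain ⟨k, ⟨S, hS⟩, htr⟩ := hF
  obtain ⟨k', _, _, t, ht, hfin⟩ := exists_transcendental_finiteDimensional_adjoin_simple S k hS (by
    intro h
    rw [trdeg_eq_zero] at htr
    exact not_lt_of_ge htr zero_lt_one)
  let e := RatFunc.algEquivOfTranscendental t ht
  let : Algebra (Polynomial k') (IntermediateField.adjoin k' {t}) :=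
    ((e : RatFunc k' →+* _).comp (algebraMap (Polynomial k') (RatFunc k'))).toAlgebra
  let e' : RatFunc k' ≃ₐ[Polynomial k'] IntermediateField.adjoin k' {t} :=
    AlgEquiv.ofRingEquiv (f := e.toRingEquiv) fun _ => rfl
  exact ⟨Polynomial k', IntermediateField.adjoin k' {t}, inferInstance, inferInstance,
    inferInstance, inferInstance, inferInstance, inferInstance,
    hasNonunitValues_polynomial k', IsLocalization.isLocalization_of_algEquiv _ e', hfin⟩

/-! ### Conclusion for number fields and function fields -/

theorem isHereditarilyNonPythagorean_of_algEquiv_mem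
    {R Q : Type*} {F : Type u} {E : Type v} {Ω : Type w} [CommRing R] [IsDomain R]
    [IsPrincipalIdealRing R]
    (hR : HasNonunitValues R) [Field Q] [Algebra R Q] [IsFractionRing R Q]
    [Field F] [Algebra Q F] [FiniteDimensional Q F] [Field E] [Field Ω] [IsAlgClosed Ω]
    [Algebra F E] [Algebra E Ω] [Algebra F Ω] [IsScalarTower F E Ω] [Algebra.IsAlgebraic F Ω]
    (h2 : (2 : Ω) ≠ 0) (N : IntermediateField E Ω)
    (hN : ∀ (h : Ω ≃ₐ[F] Ω), ∀ x ∈ N, h x ∈ N) : IsHereditarilyNonPythagorean N := by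
  intro L _ _ _ _ hL
  let : Algebra Q Ω := ((algebraMap F Ω).comp (algebraMap Q F)).toAlgebra
  have : IsScalarTower Q F Ω := .of_algebraMap_eq' rfl
  let : Algebra F N := ((algebraMap E N).comp (algebraMap F E)).toAlgebra
  have : IsScalarTower F N Ω := .of_algebraMap_eq fun x => IsScalarTower.algebraMap_apply F E Ω x
  exact not_isPythagorean_of_finite_of_not_isPurelyInseparable (Q := Q) (F := F) (Ω := Ω) hR h2
    (fun h n => ⟨⟨_, hN h _ n.2⟩, rfl⟩) hL

/-- The argument does not use that `E / F` is infinite; normality of `E / F` suffices. -/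
theorem mainTheorem6 (F : Type u) (E : Type v) (Ω : Type w) [Field F] [Field E] [Field Ω]
    [Algebra F E] [Algebra E Ω] [IsAlgClosure E Ω]
    (hF : NumberField F ∨ (ringChar F ≠ 2 ∧ IsFGTranscendentalOverSubfield F))
    (hE : IsGalois F E) (hinf : ¬ FiniteDimensional F E) :
    IsHereditarilyNonPythagorean (pythClosure E Ω) ∧
      IsHereditarilyNonPythagorean (quadClosure E Ω) := by
  let : Algebra F Ω := ((algebraMap E Ω).comp (algebraMap F E)).toAlgebra
  have : IsScalarTower F E Ω := .of_algebraMap_eq' rfl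
  have : IsAlgClosed Ω := IsAlgClosure.isAlgClosed E
  have : Algebra.IsAlgebraic F Ω := Algebra.IsAlgebraic.trans F E Ω
  have h2 : (2 : Ω) ≠ 0 := by
    have hF2 : (2 : F) ≠ 0 := by
      rcases hF with hF | ⟨hF, -⟩
      · exact two_ne_zero
      · exact Ring.two_ne_zero hF
    exact map_ofNat (algebraMap F Ω) 2 ▸ (map_ne_zero (algebraMap F Ω)).2 hF2
  rcases hF with hF | ⟨-, hF⟩
  · exact ⟨isHereditarilyNonPythagorean_of_algEquiv_mem (Q := ℚ) (F := F) hasNonunitValues_int h2 _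
      fun h _ => algEquiv_mem_pythClosure h,
      isHereditarilyNonPythagorean_of_algEquiv_mem (Q := ℚ) (F := F) hasNonunitValues_int h2 _
      fun h _ => algEquiv_mem_quadClosure h⟩
  · obtain ⟨R, Q, _, _, _, _, _, _, hR, _, _⟩ := hF.exists_finiteDimensional
    exact ⟨isHereditarilyNonPythagorean_of_algEquiv_mem (Q := Q) (F := F) hR h2 _
      fun h _ => algEquiv_mem_pythClosure h,
      isHereditarilyNonPythagorean_of_algEquiv_mem (Q := Q) (F := F) hR h2 _
      fun h _ => algEquiv_mem_quadClosure h⟩
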